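/- Let $G=(V,E)$ be a finite connected non-oriented graph without loops or multiple edges, with $N=|V|$ vertices, let $(W_e)_{e\in E}$ be positive weights, and let $i_0\in V$. Let $(Y_s)_{s\ge 0}$ be the vertex-reinforced jump process (VRJP) with weights $W$ started at $i_0$: the continuous-time jump process on $V$ with $Y_0=i_0$ which, when at vertex $i$ at time $s$, jumps, conditionally on its past $(Y_u)_{u\le s}$, to each neighbour $j$ of $i$ at rate $W_{\{i,j\}}L_j(s)$, where $L_j(s)=1+\int_0^s \mathbf 1_{\{Y_u=j\}}\,du$. Let $A(s)=\int_0^s \frac{du}{L_{Y_u}(u)}$, let $A^{-1}$ be its inverse, and let $X_t=Y_{A^{-1}(t)}$ $(t\ge 0)$ be the time-changed VRJP, with local times $T_i(t)=\int_0^t \mathbf 1_{\{X_u=i\}}\,du$. Then there are real random variables $(U_i)_{i\in V}$ such that, almost surely, for every $i\in V$, $$ \lim_{t\to\infty}\Big(T_i(t)-\frac tN\Big)=U_i . $$ -/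

import Mathlib

open MeasureTheory ProbabilityTheory Filter Topology

noncomputable section

namespace VRJP

/-! ### Functionals of a path `y : ℝ → V` (only the times `t ≥ 0` are used) -/

/-- The local time `∫₀ᵗ 1{y_s = j} ds` of the path `y` at `j` up to time `t`. -/
def localTime {V : Type*} (y : ℝ → V) (j : V) (t : ℝ) : ℝ :=
  ∫ s in (0 : ℝ)..t, Set.indicator {s : ℝ | y s = j} (fun _ => (1 : ℝ)) s

/-- The reinforced local time `L_j(t) = 1 + ∫₀ᵗ 1{y_s = j} ds`. -/
def L {V : Type*} (y : ℝ → V) (j : V) (t : ℝ) : ℝ :=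
  1 + localTime y j t

/-- The additive functional `A(s) = ∫₀ˢ du / L_{y_u}(u)`. -/
def A {V : Type*} (y : ℝ → V) (s : ℝ) : ℝ :=
  ∫ u in (0 : ℝ)..s, 1 / L y (y u) u

/-- The inverse functional `A⁻¹(t) = inf {s ≥ 0 : A(s) ≥ t}`. -/
def invA {V : Type*} (y : ℝ → V) (t : ℝ) : ℝ :=
  sInf {s : ℝ | 0 ≤ s ∧ t ≤ A y s}

/-- The time-changed path `x_t = y_{A⁻¹(t)}`. -/
def timeChange {V : Type*} (y : ℝ → V) (t : ℝ) : V :=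
  y (invA y t)

/-! ### The vertex-reinforced jump process -/

open Classical in
/-- The jump rate `W_{i,j} ℓ_j` from `i` to `j` when the reinforced local times are `ℓ`;
it vanishes unless `i ∼ j`. -/
def rate {V : Type*} (G : SimpleGraph V) (W : Sym2 V → ℝ) (i : V) (ℓ : V → ℝ) (j : V) : ℝ :=
  if G.Adj i j then W s(i, j) * ℓ j else 0

/-- The total jump rate out of `i`. -/
def totalRate {V : Type*} [Fintype V] (G : SimpleGraph V) (W : Sym2 V → ℝ) (i : V)
    (ℓ : V → ℝ) : ℝ :=
  ∑ j, rate G W i ℓ j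

open Classical in
/-- The law of the pair (holding time at `i`, next vertex), for a process which has just arrived
at `i` with reinforced local times `ℓ`. While the process sits at `i` the quantities `ℓ_j`, `j ∼ i`,
do not change, so jumping to each neighbour `j` at rate `W_{i,j} ℓ_j` means that the holding time is
exponential with parameter the total rate `r`, and that the next vertex is independent of it, equal
to `j` with probability `W_{i,j} ℓ_j / r`.
If `i` has no neighbour (`r = 0`) the process stays at `i` forever; this is encoded
by successive dummy steps from `i` to `i` of duration one. -/
def stepLaw {V : Type*} [Fintype V] [MeasurableSpace V] (G : SimpleGraph V) (W : Sym2 V → ℝ)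
    (i : V) (ℓ : V → ℝ) : Measure (ℝ × V) :=
  if totalRate G W i ℓ = 0 then Measure.dirac (1, i)
  else (expMeasure (totalRate G W i ℓ)).prod
    (∑ j, ENNReal.ofReal (rate G W i ℓ j / totalRate G W i ℓ) • Measure.dirac j)

/-- The time `τ_n = σ_0 + ⋯ + σ_{n-1}` of the `n`-th jump, for holding times `σ`. -/
def jumpTime {Ω : Type*} (σ : ℕ → Ω → ℝ) (n : ℕ) (ω : Ω) : ℝ :=
  ∑ m ∈ Finset.range n, σ m ω

/-- The past at the `n`-th jump time: the σ-algebra generated by the visited vertices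
`J_0, …, J_n` and the holding times `σ_0, …, σ_{n-1}`. -/
@[reducible] def past {Ω V : Type*} [MeasurableSpace V] (J : ℕ → Ω → V) (σ : ℕ → Ω → ℝ) (n : ℕ) :
    MeasurableSpace Ω :=
  (⨆ m ∈ Finset.range (n + 1), MeasurableSpace.comap (J m) inferInstance) ⊔
    (⨆ m ∈ Finset.range n, MeasurableSpace.comap (σ m) inferInstance)

/-- `J` and `σ` are the successive vertices and holding times of `Y`, and `Y` starts at `i₀` and
jumps, conditionally on its past, from its present vertex `i` to each neighbour `j` of `i`
at rate `W_{i,j} L_j`. -/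
structure IsVRJPWith {V : Type*} [Fintype V] [MeasurableSpace V] (G : SimpleGraph V)
    (W : Sym2 V → ℝ) (i₀ : V) {Ω : Type*} [MeasurableSpace Ω] (P : Measure Ω) (Y : ℝ → Ω → V)
    (J : ℕ → Ω → V) (σ : ℕ → Ω → ℝ) : Prop where
  measurable_vertex : ∀ n, Measurable (J n)
  measurable_holding : ∀ n, Measurable (σ n)
  start : ∀ᵐ ω ∂P, J 0 ω = i₀
  path : ∀ᵐ ω ∂P, ∀ n t, jumpTime σ n ω ≤ t → t < jumpTime σ (n + 1) ω → Y t ω = J n ω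
  step : ∀ n, ∀ S : Set (ℝ × V), MeasurableSet S →
    P⟦(fun ω => (σ n ω, J (n + 1) ω)) ⁻¹' S | past J σ n⟧ =ᵐ[P]
      fun ω => (stepLaw G W (J n ω)
        (fun j => L (fun s => Y s ω) j (jumpTime σ n ω))).real S

/-- `Y` (observed at times `t ≥ 0`) is a vertex-reinforced jump process on `G` with weights `W`,
started at `i₀`. -/
def IsVRJP {V : Type*} [Fintype V] [MeasurableSpace V] (G : SimpleGraph V)
    (W : Sym2 V → ℝ) (i₀ : V) {Ω : Type*} [MeasurableSpace Ω] (P : Measure Ω)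
    (Y : ℝ → Ω → V) : Prop :=
  ∃ (J : ℕ → Ω → V) (σ : ℕ → Ω → ℝ), IsVRJPWith G W i₀ P Y J σ

end VRJP

end

/-! Observe the process at its jumps, through the present vertex and the reinforced local times `ℓ`.
In the new clock the local time at `i` is `log ℓ_i` (`occupation_clock`), and the elapsed time is
the sum of these logarithms. The centred local time is therefore `log ℓ_i` minus the average of the
`log ℓ_j`, a function of the ratios `ℓ_j / ℓ_i` alone, and it is enough that these ratios converge
to positive limits.

Convergence comes from one martingale per vertex. With `r_j(ℓ) = ∑_k W_{jk} ℓ_k`, the quantity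
`r_j(ℓ) / ℓ_j + 1{i ≠ j} / ℓ_j²` is nonnegative and preserved in mean by one step
(`stepIntegral_harmonic`), so it converges almost surely (`IsVRJPWith.ae_tendsto_harmonic`). Its
boundedness controls the ratio across each edge and, by connectedness, all ratios
(`exists_ratio_bound`). The total local time diverges because a Gaussian function of it has
geometrically decaying mean (`IsVRJPWith.ae_tendsto_sum_reinforced`). Hence every `ℓ_j` diverges,
the correction `1 / ℓ_j²` disappears, and `r_j(ℓ) / ℓ_j` has a limit `b_j`. A cluster point of the
ratios is a positive solution of `r_j(u) = b_j u_j` normalised at one vertex; a minimum principle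
makes it unique (`eq_of_totalRate_eq`), and compactness turns uniqueness into convergence
(`exists_tendsto_ratio`).

Between jumps the centred local times are affine in time, so the limit along jumps is the limit
along all times (`IsStepPath.tendsto_localTime_sub`). -/

noncomputable section

namespace VRJP

/-! ### Step paths, occupation times and the time change -/

section Paths

open Classical

/-- Every time `t ≥ τ 0` lies in one of the intervals cut out by an unbounded sequence `τ`. -/
lemma exists_mem_Ico_of_tendsto {τ : ℕ → ℝ} (hτ : Tendsto τ atTop atTop) {k : ℕ} {t : ℝ}
    (ht : τ k ≤ t) : ∃ n, k ≤ n ∧ τ n ≤ t ∧ t < τ (n + 1) := by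
  obtain ⟨m, hm⟩ := (hτ.eventually_gt_atTop t).exists_forall_of_atTop
  have hex : ∃ n, k ≤ n ∧ t < τ (n + 1) :=
    ⟨max k m, le_max_left _ _, hm _ ((le_max_right k m).trans (Nat.le_succ _))⟩
  obtain ⟨hk, hlt⟩ := Nat.find_spec hex
  refine ⟨Nat.find hex, hk, ?_, hlt⟩
  by_contra! hcon
  rcases hk.eq_or_lt with h | h
  · rw [← h] at hcon; exact absurd ht (not_le.2 hcon)
  · refine Nat.find_min hex (m := Nat.find hex - 1) (by omega) ⟨by omega, ?_⟩
    rwa [Nat.sub_add_cancel (by omega)]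

/-- Integral of a function with continuous pieces, in terms of antiderivatives of the pieces. -/
lemma integral_of_pieces {τ : ℕ → ℝ} (hτ : StrictMono τ) {f : ℝ → ℝ} {g G : ℕ → ℝ → ℝ}
    (hf : ∀ n, ∀ s ∈ Set.Ico (τ n) (τ (n + 1)), f s = g n s)
    (hg : ∀ n, ContinuousOn (g n) (Set.Icc (τ n) (τ (n + 1))))
    (hG : ∀ n, ∀ s ∈ Set.Icc (τ n) (τ (n + 1)), HasDerivAt (G n) (g n s) s)
    (n : ℕ) {t : ℝ} (ht : t ∈ Set.Icc (τ n) (τ (n + 1))) :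
    ∫ s in (τ 0)..t, f s
      = ∑ m ∈ Finset.range n, (G m (τ (m + 1)) - G m (τ m)) + (G n t - G n (τ n)) := by
  have piece : ∀ n, ∀ t ∈ Set.Icc (τ n) (τ (n + 1)),
      IntervalIntegrable f volume (τ n) t ∧ ∫ s in (τ n)..t, f s = G n t - G n (τ n) := by
    intro n t ht
    have hsub : Set.uIcc (τ n) t ⊆ Set.Icc (τ n) (τ (n + 1)) := by
      rw [Set.uIcc_of_le ht.1]; exact Set.Icc_subset_Icc_right ht.2
    have hgi : IntervalIntegrable (g n) volume (τ n) t :=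
      ((hg n).mono hsub).intervalIntegrable
    -- The pieces describe `f` only on half-open intervals; the right endpoint is discarded as a
    -- null set.
    have hae : ∀ᵐ s ∂volume, s ∈ Set.uIoc (τ n) t → g n s = f s := by
      have : ∀ᵐ s ∂(volume : Measure ℝ), s ≠ t := by
        simp [ae_iff]
      filter_upwards [this] with s hs hmem
      rw [Set.uIoc_of_le ht.1] at hmem
      exact (hf n s ⟨hmem.1.le, (lt_of_le_of_ne hmem.2 hs).trans_le ht.2⟩).symm
    refine ⟨hgi.congr_ae ((ae_restrict_iff' measurableSet_uIoc).2 hae), ?_⟩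
    rw [← intervalIntegral.integral_congr_ae hae]
    exact intervalIntegral.integral_eq_sub_of_hasDerivAt (fun s hs => hG n s (hsub hs)) hgi
  have whole : ∀ n, IntervalIntegrable f volume (τ 0) (τ n) ∧
      ∫ s in (τ 0)..(τ n), f s = ∑ m ∈ Finset.range n, (G m (τ (m + 1)) - G m (τ m)) := by
    intro n
    induction n with
    | zero => simp
    | succ n ih =>
      obtain ⟨h1, h2⟩ := piece n (τ (n + 1)) ⟨(hτ n.lt_succ_self).le, le_rfl⟩
      refine ⟨ih.1.trans h1, ?_⟩
      rw [← intervalIntegral.integral_add_adjacent_intervals ih.1 h1, ih.2, h2,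
        Finset.sum_range_succ]
  rw [← intervalIntegral.integral_add_adjacent_intervals (whole n).1 (piece n t ht).1,
    (whole n).2, (piece n t ht).2]

variable {V : Type*}

/-- `y` is the right-continuous step path visiting the vertices `J 0, J 1, …` in this order,
with jump times `τ 1, τ 2, …`. -/
structure IsStepPath (y : ℝ → V) (J : ℕ → V) (τ : ℕ → ℝ) : Prop where
  zero : τ 0 = 0
  strictMono : StrictMono τ
  eq : ∀ n t, τ n ≤ t → t < τ (n + 1) → y t = J n

/-- The time spent at `j` before the `n`-th jump. -/
def occupation (J : ℕ → V) (τ : ℕ → ℝ) (n : ℕ) (j : V) : ℝ :=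
  ∑ m ∈ Finset.range n, if J m = j then τ (m + 1) - τ m else 0

lemma occupation_nonneg {J : ℕ → V} {τ : ℕ → ℝ} (hτ : StrictMono τ) (n : ℕ) (j : V) :
    0 ≤ occupation J τ n j := by
  refine Finset.sum_nonneg fun m _ => ?_
  split_ifs
  · exact sub_nonneg.2 (hτ m.lt_succ_self).le
  · exact le_rfl

/-- The closed interval matters: the formula at its right endpoint gives the increment of the
occupation time over a whole sojourn. -/
lemma IsStepPath.localTime_eq {y : ℝ → V} {J : ℕ → V} {τ : ℕ → ℝ} (h : IsStepPath y J τ)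
    (j : V) (n : ℕ) {t : ℝ} (ht : t ∈ Set.Icc (τ n) (τ (n + 1))) :
    localTime y j t = occupation J τ n j + if J n = j then t - τ n else 0 := by
  rw [localTime, ← h.zero, integral_of_pieces h.strictMono
    (g := fun n _ => if J n = j then 1 else 0) (G := fun n s => if J n = j then s else 0)
    ?_ (fun n => continuousOn_const) ?_ n ht, occupation]
  · congr 1
    · refine Finset.sum_congr rfl fun m _ => ?_
      split_ifs <;> simp
    · split_ifs <;> simp [h.zero]
  · intro n s hs
    simp [Set.indicator_apply, h.eq n s hs.1 hs.2]
  · intro n s _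
    by_cases hj : J n = j
    · simpa [hj] using hasDerivAt_id' s
    · simpa [hj] using hasDerivAt_const s (0 : ℝ)

lemma IsStepPath.localTime_jump {y : ℝ → V} {J : ℕ → V} {τ : ℕ → ℝ} (h : IsStepPath y J τ)
    (j : V) (n : ℕ) : localTime y j (τ n) = occupation J τ n j := by
  rw [h.localTime_eq j n ⟨le_rfl, (h.strictMono n.lt_succ_self).le⟩]
  simp

lemma one_add_occupation_pos {J : ℕ → V} {τ : ℕ → ℝ} (hτ : StrictMono τ) (n : ℕ) (j : V) :
    0 < 1 + occupation J τ n j := by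
  linarith [occupation_nonneg (J := J) hτ n j]

lemma occupation_succ_self (J : ℕ → V) (τ : ℕ → ℝ) (n : ℕ) :
    occupation J τ (n + 1) (J n) = occupation J τ n (J n) + (τ (n + 1) - τ n) := by
  simp [occupation, Finset.sum_range_succ]

lemma occupation_succ_of_ne (J : ℕ → V) (τ : ℕ → ℝ) (n : ℕ) {j : V} (hj : J n ≠ j) :
    occupation J τ (n + 1) j = occupation J τ n j := by
  simp [occupation, Finset.sum_range_succ, hj]

/-- For a step path, the centred local times converge as soon as they do along the jump times. -/
lemma IsStepPath.tendsto_localTime_sub {y : ℝ → V} {J : ℕ → V} {τ : ℕ → ℝ}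
    (h : IsStepPath y J τ) (hτ : Tendsto τ atTop atTop) (j : V) {c u : ℝ}
    (hu : Tendsto (fun n => occupation J τ n j - τ n / c) atTop (𝓝 u)) :
    Tendsto (fun t => localTime y j t - t / c) atTop (𝓝 u) := by
  rw [Metric.tendsto_atTop] at hu ⊢
  intro ε hε
  obtain ⟨k, hk⟩ := hu ε hε
  refine ⟨τ k, fun t ht => ?_⟩
  obtain ⟨n, hkn, hn1, hn2⟩ := exists_mem_Ico_of_tendsto hτ ht
  have e1 := hk n hkn
  have e2 := hk (n + 1) (by omega)
  rw [← h.localTime_jump, h.localTime_eq j n ⟨(h.strictMono n.lt_succ_self).le, le_rfl⟩] at e2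
  rw [h.localTime_eq j n ⟨hn1, hn2.le⟩]
  rw [Real.dist_eq, abs_lt] at *
  -- On one sojourn the centred local time is affine with slope `d`, hence lies between its values
  -- at the two jumps.
  obtain ⟨d, hd⟩ : ∃ d : ℝ, ∀ t, (if J n = j then t - τ n else 0) - t / c
      = d * (t - τ n) - τ n / c := by
    by_cases hj : J n = j
    · exact ⟨1 - 1 / c, fun t => by simp [hj]; ring⟩
    · exact ⟨- (1 / c), fun t => by simp [hj]; ring⟩
  rw [add_sub_assoc, hd] at *
  rcases le_total 0 d with h0 | h0
  · have := mul_nonneg h0 (sub_nonneg.2 hn1)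
    have := mul_le_mul_of_nonneg_left (sub_le_sub_right hn2.le (τ n)) h0
    constructor <;> linarith
  · have := mul_nonneg_of_nonpos_of_nonpos h0 (sub_nonpos.2 hn1)
    have := mul_le_mul_of_nonpos_left (sub_le_sub_right hn2.le (τ n)) h0
    have := mul_nonpos_of_nonpos_of_nonneg h0 (sub_nonneg.2 hn1)
    constructor <;> linarith

variable [Fintype V]

lemma sum_occupation {J : ℕ → V} {τ : ℕ → ℝ} (h0 : τ 0 = 0) (n : ℕ) :
    ∑ j, occupation J τ n j = τ n := by
  simp only [occupation]
  rw [Finset.sum_comm]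
  simp only [Finset.sum_ite_eq, Finset.mem_univ, if_true]
  rw [Finset.sum_range_sub, h0, sub_zero]

/-- The value of the additive functional `A` at the `n`-th jump. -/
def clock (J : ℕ → V) (τ : ℕ → ℝ) (n : ℕ) : ℝ :=
  ∑ j, Real.log (1 + occupation J τ n j)

lemma clock_succ_sub (J : ℕ → V) (τ : ℕ → ℝ) (n : ℕ) :
    clock J τ (n + 1) - clock J τ n = Real.log (1 + occupation J τ (n + 1) (J n))
      - Real.log (1 + occupation J τ n (J n)) := by
  rw [clock, clock, ← Finset.sum_sub_distrib]
  refine Finset.sum_eq_single (J n) (fun j _ hj => ?_) (by simp)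
  rw [occupation_succ_of_ne J τ n (Ne.symm hj), sub_self]

lemma clock_strictMono {J : ℕ → V} {τ : ℕ → ℝ} (hτ : StrictMono τ) :
    StrictMono (clock J τ) := by
  refine strictMono_nat_of_lt_succ fun n => ?_
  rw [← sub_pos, clock_succ_sub, sub_pos]
  refine Real.log_lt_log (one_add_occupation_pos hτ _ _) ?_
  rw [occupation_succ_self]
  linarith [hτ n.lt_succ_self]

lemma clock_zero (J : ℕ → V) (τ : ℕ → ℝ) : clock J τ 0 = 0 := by
  simp [clock, occupation]

/-- `log (1 + ·)` of the occupation times is the occupation times for the clock `clock`. -/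
lemma occupation_clock (J : ℕ → V) (τ : ℕ → ℝ) (n : ℕ) (j : V) :
    occupation J (clock J τ) n j = Real.log (1 + occupation J τ n j) := by
  induction n with
  | zero => simp [occupation]
  | succ n ih =>
    by_cases hj : J n = j
    · subst hj
      rw [occupation_succ_self, ih, clock_succ_sub]
      ring
    · rw [occupation_succ_of_ne _ _ _ hj, occupation_succ_of_ne _ _ _ hj, ih]

/-- During a sojourn the integrand is the reciprocal of a local time growing at unit speed, so its
primitive is a logarithm; only the term of the occupied vertex moves in the sum defining `clock`. -/
lemma IsStepPath.A_eq {y : ℝ → V} {J : ℕ → V} {τ : ℕ → ℝ} (h : IsStepPath y J τ)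
    (n : ℕ) {t : ℝ} (ht : t ∈ Set.Icc (τ n) (τ (n + 1))) :
    A y t = clock J τ n + (Real.log (1 + occupation J τ n (J n) + (t - τ n))
      - Real.log (1 + occupation J τ n (J n))) := by
  have hpos : ∀ n, ∀ s ∈ Set.Icc (τ n) (τ (n + 1)),
      0 < 1 + occupation J τ n (J n) + (s - τ n) := fun n s hs => by
    linarith [one_add_occupation_pos (J := J) h.strictMono n (J n), hs.1]
  rw [A, ← h.zero, integral_of_pieces h.strictMono
    (g := fun n s => 1 / (1 + occupation J τ n (J n) + (s - τ n)))
    (G := fun n s => Real.log (1 + occupation J τ n (J n) + (s - τ n))) ?_ ?_ ?_ n ht]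
  · simp only [sub_self, add_zero]
    congr 1
    rw [← sub_zero (clock J τ n), ← clock_zero J τ, ← Finset.sum_range_sub]
    refine Finset.sum_congr rfl fun m _ => ?_
    rw [clock_succ_sub, occupation_succ_self, add_assoc]
  · intro n s hs
    rw [h.eq n s hs.1 hs.2, L, h.localTime_eq _ n ⟨hs.1, hs.2.le⟩]
    simp [add_assoc]
  · intro n
    refine ContinuousOn.div continuousOn_const (by fun_prop) fun s hs => (hpos n s hs).ne'
  · intro n s hs
    exact (((hasDerivAt_id s).sub_const (τ n)).const_add _).log (hpos n s hs).ne'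

/-- `A` increases continuously from `clock J τ n` to `clock J τ (n + 1)` during the `n`-th sojourn,
so its inverse sends the new interval back into the old one. -/
lemma IsStepPath.timeChange {y : ℝ → V} {J : ℕ → V} {τ : ℕ → ℝ} (h : IsStepPath y J τ)
    (hτ : Tendsto τ atTop atTop) : IsStepPath (timeChange y) J (clock J τ) := by
  refine ⟨clock_zero J τ, clock_strictMono h.strictMono, fun n u hu1 hu2 => ?_⟩
  set ℓ := 1 + occupation J τ n (J n) with hℓ
  have hℓ0 : 0 < ℓ := one_add_occupation_pos h.strictMono n (J n)
  have hcs := clock_succ_sub J τ n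
  rw [occupation_succ_self, ← add_assoc, ← hℓ] at hcs
  have hΔ : 0 < τ (n + 1) - τ n := sub_pos.2 (h.strictMono n.lt_succ_self)
  -- The solution of `A y s = u` on the `n`-th sojourn, from the logarithmic formula
  -- `IsStepPath.A_eq`.
  set s := τ n + ℓ * (Real.exp (u - clock J τ n) - 1) with hs
  have hs1 : τ n ≤ s := by
    have : 1 ≤ Real.exp (u - clock J τ n) := Real.one_le_exp (sub_nonneg.2 hu1)
    have := mul_nonneg hℓ0.le (sub_nonneg.2 this)
    linarith
  have hs2 : s < τ (n + 1) := by
    have h1 : Real.exp (u - clock J τ n) < (ℓ + (τ (n + 1) - τ n)) / ℓ := by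
      rw [← Real.lt_log_iff_exp_lt (by positivity), Real.log_div (by positivity) hℓ0.ne']
      linarith
    rw [lt_div_iff₀ hℓ0] at h1
    rw [hs]
    linarith
  have hτ0 : ∀ m, 0 ≤ τ m := fun m => h.zero ▸ h.strictMono.monotone (Nat.zero_le m)
  -- Earlier sojourns stay below level `u`, later ones above it, and the `n`-th crosses it exactly
  -- at `s`.
  have key : {x : ℝ | 0 ≤ x ∧ u ≤ A y x} = Set.Ici s := by
    ext x
    simp only [Set.mem_ofPred_eq, Set.mem_Ici]
    by_cases hx0 : 0 ≤ x
    · obtain ⟨m, -, hm1, hm2⟩ := exists_mem_Ico_of_tendsto hτ (k := 0) (t := x) (by rwa [h.zero])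
      have hAx := h.A_eq m ⟨hm1, hm2.le⟩
      have hm0 : 0 < 1 + occupation J τ m (J m) := one_add_occupation_pos h.strictMono m (J m)
      have hcsm := clock_succ_sub J τ m
      rw [occupation_succ_self, ← add_assoc] at hcsm
      have hlog1 : Real.log (1 + occupation J τ m (J m))
          ≤ Real.log (1 + occupation J τ m (J m) + (x - τ m)) :=
        Real.log_le_log hm0 (by linarith)
      have hlog2 : Real.log (1 + occupation J τ m (J m) + (x - τ m))
          < Real.log (1 + occupation J τ m (J m) + (τ (m + 1) - τ m)) :=
        Real.log_lt_log (by linarith) (by linarith)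
      simp only [hx0, true_and]
      rcases lt_trichotomy m n with hmn | rfl | hmn
      · have h1 : clock J τ (m + 1) ≤ clock J τ n :=
          (clock_strictMono h.strictMono).monotone hmn
        have h2 : τ (m + 1) ≤ τ n := h.strictMono.monotone hmn
        exact iff_of_false (by linarith) (by linarith)
      · rw [hAx, ← sub_le_iff_le_add', le_sub_iff_add_le,
          Real.le_log_iff_exp_le (by linarith), Real.exp_add, Real.exp_log hm0, hs]
        constructor <;> intro h <;> linarith
      · have h1 : clock J τ (n + 1) ≤ clock J τ m :=
          (clock_strictMono h.strictMono).monotone hmn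
        have h2 : τ (n + 1) ≤ τ m := h.strictMono.monotone hmn
        exact iff_of_true (by linarith) (by linarith)
    · exact iff_of_false (fun h => hx0 h.1) (by linarith [hτ0 n])
  rw [VRJP.timeChange, invA, key, csInf_Ici]
  exact h.eq n s hs1 hs2

/-- All summands of `clock` are nonnegative, so a bound `b` on it bounds each occupation time by
`exp b`, and their sum `τ n` by `card V * exp b`. -/
lemma clock_tendsto {J : ℕ → V} {τ : ℕ → ℝ} (h0 : τ 0 = 0) (hmono : StrictMono τ)
    (hτ : Tendsto τ atTop atTop) : Tendsto (clock J τ) atTop atTop := by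
  refine tendsto_atTop_atTop_of_monotone (clock_strictMono hmono).monotone fun b => ?_
  obtain ⟨n, hn⟩ := (hτ.eventually_gt_atTop (Fintype.card V * Real.exp b)).exists
  refine ⟨n, ?_⟩
  by_contra! hcon
  have hle : ∀ j, occupation J τ n j ≤ Real.exp b := fun j => by
    have hnn : ∀ k, 0 ≤ Real.log (1 + occupation J τ n k) := fun k =>
      Real.log_nonneg (by linarith [occupation_nonneg (J := J) hmono n k])
    have h1 : Real.log (1 + occupation J τ n j) ≤ clock J τ n :=
      Finset.single_le_sum (f := fun k => Real.log (1 + occupation J τ n k))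
        (fun k _ => hnn k) (Finset.mem_univ j)
    have h2 := (Real.log_le_iff_le_exp (one_add_occupation_pos (J := J) hmono n j)).1
      (h1.trans hcon.le)
    linarith
  have := Finset.sum_le_sum fun j (_ : j ∈ Finset.univ) => hle j
  rw [sum_occupation h0] at this
  simp at this
  linarith

end Paths

/-! ### Deterministic convergence of the ratios of local times -/

section Ratios

open Classical

variable {V : Type*} (G : SimpleGraph V) (W : Sym2 V → ℝ)

/-- The weight of the edge `{i, j}`, zero if `i` and `j` are not adjacent. -/
def weight (i j : V) : ℝ :=
  if G.Adj i j then W s(i, j) else 0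

lemma rate_eq (i : V) (ℓ : V → ℝ) (j : V) : rate G W i ℓ j = weight G W i j * ℓ j := by
  by_cases h : G.Adj i j <;> simp [rate, weight, h]

lemma weight_comm (i j : V) : weight G W i j = weight G W j i := by
  simp [weight, G.adj_comm i j, Sym2.eq_swap]

lemma weight_self (i : V) : weight G W i i = 0 := by simp [weight]

variable {G W}

lemma weight_pos (hW : ∀ e ∈ G.edgeSet, 0 < W e) {i j : V} (h : G.Adj i j) :
    0 < weight G W i j := by
  simpa [weight, h] using hW s(i, j) h

lemma weight_nonneg (hW : ∀ e ∈ G.edgeSet, 0 < W e) (i j : V) : 0 ≤ weight G W i j := by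
  by_cases h : G.Adj i j
  · exact (weight_pos hW h).le
  · simp [weight, h]

lemma rate_nonneg (hW : ∀ e ∈ G.edgeSet, 0 < W e) {ℓ : V → ℝ} (hℓ : ∀ j, 0 ≤ ℓ j) (i k : V) :
    0 ≤ rate G W i ℓ k := by
  rw [rate_eq]; exact mul_nonneg (weight_nonneg hW i k) (hℓ k)

variable [Fintype V]

lemma totalRate_eq (i : V) (ℓ : V → ℝ) :
    totalRate G W i ℓ = ∑ j, weight G W i j * ℓ j := by
  simp [totalRate, rate_eq]

lemma weight_mul_le_totalRate (hW : ∀ e ∈ G.edgeSet, 0 < W e) {ℓ : V → ℝ} (hℓ : ∀ j, 0 ≤ ℓ j)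
    (i j : V) : weight G W i j * ℓ j ≤ totalRate G W i ℓ := by
  rw [totalRate_eq]
  exact Finset.single_le_sum (f := fun j => weight G W i j * ℓ j)
    (fun k _ => mul_nonneg (weight_nonneg hW i k) (hℓ k)) (Finset.mem_univ j)

/-- If `r_j(ℓ) ≤ B_j ℓ_j` for all `j`, the ratios `ℓ_k / ℓ_j` are bounded. -/
lemma exists_ratio_bound (hG : G.Connected) (hW : ∀ e ∈ G.edgeSet, 0 < W e) {ι : Type*}
    {ℓ : ι → V → ℝ} (hℓ : ∀ n j, 0 < ℓ n j) {B : V → ℝ}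
    (hB : ∀ n j, totalRate G W j (ℓ n) ≤ B j * ℓ n j) :
    ∃ C, 0 < C ∧ ∀ n j k, ℓ n k ≤ C * ℓ n j := by
  have step : ∀ j k, ∃ C, 0 < C ∧ ∀ n, ℓ n k ≤ C * ℓ n j := by
    intro j k
    obtain ⟨p⟩ := hG.preconnected j k
    induction p with
    | nil => exact ⟨1, one_pos, fun n => by simp⟩
    | @cons u v w huv p ih =>
      obtain ⟨C, hC, h⟩ := ih
      have hw := weight_pos hW huv
      -- Across an edge, `weight * ℓ_v ≤ r_u(ℓ) ≤ B_u ℓ_u`. The absolute value and the `+ 1` only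
      -- keep the constant positive whatever the sign of `B u`.
      refine ⟨C * (|B u| / weight G W u v + 1), by positivity, fun n => (h n).trans ?_⟩
      rw [mul_assoc]
      refine mul_le_mul_of_nonneg_left ?_ hC.le
      have h1 := (weight_mul_le_totalRate hW (fun j => (hℓ n j).le) u v).trans (hB n u)
      have h2 : ℓ n v ≤ B u * ℓ n u / weight G W u v := by
        rw [le_div_iff₀ hw]; linarith
      have h3 : B u * ℓ n u / weight G W u v ≤ |B u| / weight G W u v * ℓ n u := by
        rw [div_mul_eq_mul_div]
        gcongr
        · exact (hℓ n u).le
        · exact le_abs_self _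
      linarith [hℓ n u]
  choose C hC h using step
  have hsum : ∀ j k, C j k ≤ ∑ j, ∑ k, C j k := fun j k =>
    (Finset.single_le_sum (f := fun k => C j k) (fun k _ => (hC j k).le) (Finset.mem_univ k)).trans
      (Finset.single_le_sum (f := fun j => ∑ k, C j k)
        (fun j _ => Finset.sum_nonneg fun k _ => (hC j k).le) (Finset.mem_univ j))
  obtain ⟨o⟩ := hG.nonempty
  exact ⟨∑ j, ∑ k, C j k, (hC o o).trans_le (hsum o o), fun n j k =>
    (h j k n).trans (mul_le_mul_of_nonneg_right (hsum j k) (hℓ n j).le)⟩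

/-- A positive eigenfunction (with prescribed potential `b`) of a connected weighted graph is
unique up to a multiplicative constant. -/
lemma eq_of_totalRate_eq (hG : G.Connected) (hW : ∀ e ∈ G.edgeSet, 0 < W e) {b u v : V → ℝ}
    (hv0 : ∀ j, 0 < v j) (hu : ∀ j, totalRate G W j u = b j * u j)
    (hv : ∀ j, totalRate G W j v = b j * v j) {o : V} (ho : u o = v o) : u = v := by
  have : Nonempty V := ⟨o⟩
  -- Minimum principle: `m` is the largest constant with `u - m v ≥ 0`, and `i` is a zero of this
  -- difference. Zeros spread along edges, so `u = m v`.
  obtain ⟨i, hi⟩ := Finite.exists_min fun j => u j / v j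
  set m := u i / v i with hm
  have hd : ∀ j, 0 ≤ u j - m * v j := fun j => by
    have := (le_div_iff₀ (hv0 j)).1 (hi j)
    linarith
  have hz : ∀ j, u j - m * v j = 0 := by
    intro j
    obtain ⟨p⟩ := hG.preconnected j i
    induction p with
    | nil => rw [hm, div_mul_cancel₀ _ (hv0 _).ne', sub_self]
    | @cons a c w hac p ih =>
      have ih : u c - m * v c = 0 := ih hi hm hd
      -- At a zero `c` the two eigenvalue equations make this sum vanish; its terms are nonnegative,
      -- so every neighbour of `c` is a zero.
      have hsum : ∑ k, weight G W c k * (u k - m * v k) = 0 := by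
        have h1 := hu c
        have h2 := hv c
        rw [totalRate_eq] at h1 h2
        have : ∑ k, weight G W c k * (u k - m * v k)
            = ∑ k, weight G W c k * u k - m * ∑ k, weight G W c k * v k := by
          rw [Finset.mul_sum, ← Finset.sum_sub_distrib]
          exact Finset.sum_congr rfl fun k _ => by ring
        rw [this, h1, h2]
        linear_combination b c * ih
      have := (Finset.sum_eq_zero_iff_of_nonneg fun k _ =>
        mul_nonneg (weight_nonneg hW c k) (hd k)).1 hsum a (Finset.mem_univ a)
      exact (mul_eq_zero.1 this).resolve_left (weight_pos hW hac.symm).ne'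
  have hm1 : m = 1 := by
    have h1 := hz o
    rw [ho] at h1
    have h2 : (1 - m) * v o = 0 := by linear_combination h1
    linarith [(mul_eq_zero.1 h2).resolve_right (hv0 o).ne']
  funext j
  have := hz j
  rw [hm1] at this
  linarith

lemma continuous_totalRate (i : V) : Continuous fun ℓ : V → ℝ => totalRate G W i ℓ := by
  simp only [totalRate_eq]
  fun_prop

lemma totalRate_div (i : V) (ℓ : V → ℝ) (c : ℝ) :
    totalRate G W i (fun j => ℓ j / c) = totalRate G W i ℓ / c := by
  simp only [totalRate_eq, Finset.sum_div, mul_div_assoc]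

/-- Convergence of all the quotients `r_j(ℓ) / ℓ_j` forces convergence of the ratios `ℓ_j / ℓ_o`. -/
lemma exists_tendsto_ratio (hG : G.Connected) (hW : ∀ e ∈ G.edgeSet, 0 < W e) {ℓ : ℕ → V → ℝ}
    (hℓ : ∀ n j, 0 < ℓ n j) {C : ℝ} (hC : 0 < C) (hratio : ∀ n j k, ℓ n k ≤ C * ℓ n j) {b : V → ℝ}
    (hb : ∀ j, Tendsto (fun n => totalRate G W j (ℓ n) / ℓ n j) atTop (𝓝 (b j))) (o : V) :
    ∃ u : V → ℝ, (∀ j, 0 < u j) ∧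
      ∀ j, Tendsto (fun n => ℓ n j / ℓ n o) atTop (𝓝 (u j)) := by
  set f : ℕ → V → ℝ := fun n j => ℓ n j / ℓ n o with hf
  set K : Set (V → ℝ) := Set.univ.pi fun _ => Set.Icc C⁻¹ C with hK
  have hKc : IsCompact K := isCompact_univ_pi fun _ => isCompact_Icc
  have hfK : ∀ n, f n ∈ K := fun n j _ => by
    constructor
    · rw [hf, le_div_iff₀ (hℓ n o), inv_mul_le_iff₀ hC]; exact hratio n j o
    · rw [hf, div_le_iff₀ (hℓ n o)]; exact hratio n o j
  have hpos : ∀ u ∈ K, ∀ j, 0 < u j := fun u hu j => (inv_pos.2 hC).trans_le (hu j trivial).1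
  have hlim : ∀ u ∈ K, MapClusterPt u atTop f →
      u o = 1 ∧ ∀ j, totalRate G W j u = b j * u j := by
    intro u hu hcl
    -- A limit known along the whole sequence is inherited by every cluster point; this is applied
    -- to the normalisation and to the quotients `r_j / ℓ_j`.
    have aux : ∀ (Φ : (V → ℝ) → ℝ) (c : ℝ), ContinuousAt Φ u →
        Tendsto (fun n => Φ (f n)) atTop (𝓝 c) → Φ u = c := by
      intro Φ c hΦ hc
      have h1 : ClusterPt (Φ u) (𝓝 c) := (hcl.continuousAt_comp hΦ).clusterPt.mono hc
      exact eq_of_nhds_neBot h1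
    refine ⟨aux (fun v => v o) 1 (continuous_apply o).continuousAt ?_, fun j => ?_⟩
    · simp [hf, div_self (hℓ _ o).ne']
    · rw [← div_eq_iff (hpos u hu j).ne']
      refine aux (fun v => totalRate G W j v / v j) (b j)
        ((continuous_totalRate j).continuousAt.div (continuous_apply j).continuousAt (hpos u hu j).ne') ?_
      refine (hb j).congr fun n => ?_
      rw [hf, totalRate_div, div_div_div_cancel_right₀ (hℓ n o).ne']
  obtain ⟨u, huK, hu⟩ := hKc.exists_mapClusterPt (u := f) (f := atTop)
    (tendsto_principal.2 (Eventually.of_forall hfK))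
  refine ⟨u, hpos u huK, tendsto_pi_nhds.1 ?_⟩
  refine hKc.tendsto_nhds_of_unique_mapClusterPt (Eventually.of_forall hfK) fun v hvK hv => ?_
  obtain ⟨hu1, hu2⟩ := hlim u huK hu
  obtain ⟨hv1, hv2⟩ := hlim v hvK hv
  exact eq_of_totalRate_eq hG hW (hpos u huK) hv2 hu2 (hv1.trans hu1.symm)

/-- If `ℓ` has unbounded sum and the quantities `r_j(ℓ) / ℓ_j + 1{x ≠ j} / ℓ_j²` converge, so do
the centred logarithms of the `ℓ_j`. -/
lemma exists_tendsto_log_sub (hG : G.Connected) (hW : ∀ e ∈ G.edgeSet, 0 < W e)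
    {ℓ : ℕ → V → ℝ} {x : ℕ → V} (hℓ : ∀ n j, 0 < ℓ n j)
    (hsum : Tendsto (fun n => ∑ j, ℓ n j) atTop atTop)
    (hM : ∀ j, ∃ c, Tendsto (fun n => totalRate G W j (ℓ n) / ℓ n j
      + if x n = j then 0 else 1 / ℓ n j ^ 2) atTop (𝓝 c)) (i : V) :
    ∃ u, Tendsto (fun n => Real.log (ℓ n i) - (∑ j, Real.log (ℓ n j)) / Fintype.card V)
      atTop (𝓝 u) := by
  choose b hb using hM
  have hnn : ∀ n j, 0 ≤ if x n = j then 0 else 1 / ℓ n j ^ 2 := fun n j => by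
    have := hℓ n j
    split_ifs <;> positivity
  obtain ⟨C, hC, hratio⟩ : ∃ C, 0 < C ∧ ∀ n j k, ℓ n k ≤ C * ℓ n j := by
    choose B hB using fun j => (hb j).bddAbove_range
    refine exists_ratio_bound hG hW hℓ (B := B) fun n j => ?_
    have := hB j ⟨n, rfl⟩
    rw [← div_le_iff₀ (hℓ n j)]
    linarith [hnn n j]
  -- Comparable terms with diverging sum all diverge: the sum is at most `card V * C * ℓ n j`.
  have hinf : ∀ j, Tendsto (fun n => ℓ n j) atTop atTop := fun j => by
    refine tendsto_atTop_mono (fun n => ?_) (hsum.atTop_div_const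
      (r := Fintype.card V * C + 1) (by positivity))
    rw [div_le_iff₀ (by positivity)]
    have := Finset.sum_le_sum fun k (_ : k ∈ Finset.univ) => hratio n j k
    simp at this
    linarith [hℓ n j]
  have hb' : ∀ j, Tendsto (fun n => totalRate G W j (ℓ n) / ℓ n j) atTop (𝓝 (b j)) := fun j => by
    have h0 : Tendsto (fun n => 1 / ℓ n j ^ 2) atTop (𝓝 0) := by
      refine ((tendsto_pow_atTop two_ne_zero).comp (hinf j)).inv_tendsto_atTop.congr fun n => ?_
      simp
    have h1 : Tendsto (fun n => if x n = j then 0 else 1 / ℓ n j ^ 2) atTop (𝓝 0) :=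
      squeeze_zero (fun n => hnn n j) (fun n => by
        have := hℓ n j
        split_ifs
        · positivity
        · exact le_rfl) h0
    simpa using (hb j).sub h1
  obtain ⟨u, hu0, hu⟩ := exists_tendsto_ratio hG hW hℓ hC hratio hb' i
  -- Dividing every `ℓ_j` by `ℓ_i` leaves the centred logarithm unchanged; the `0` stands for `log
  -- (ℓ_i / ℓ_i)`.
  refine ⟨0 - (∑ j, Real.log (u j)) / Fintype.card V, ?_⟩
  have key : Tendsto (fun n => 0 - (∑ j, Real.log (ℓ n j / ℓ n i)) / Fintype.card V) atTop
      (𝓝 (0 - (∑ j, Real.log (u j)) / Fintype.card V)) :=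
    tendsto_const_nhds.sub
      ((tendsto_finsetSum _ fun j _ => (hu j).log (hu0 j).ne').div_const _)
  refine key.congr fun n => ?_
  have hc : (Fintype.card V : ℝ) ≠ 0 := by
    have : Nonempty V := ⟨i⟩
    exact_mod_cast Fintype.card_ne_zero
  simp only [Real.log_div (hℓ n _).ne' (hℓ n i).ne', Finset.sum_sub_distrib, Finset.sum_const,
    Finset.card_univ, nsmul_eq_mul]
  field_simp
  ring

end Ratios

/-! ### The chain of vertices and reinforced local times -/

section State

open Classical

variable {V : Type*}

/-- The reinforced local times after a sojourn of length `s` at `i`. -/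
def advance (i : V) (ℓ : V → ℝ) (s : ℝ) (j : V) : ℝ :=
  ℓ j + if i = j then s else 0

variable {Ω : Type*} {J : ℕ → Ω → V} {σ : ℕ → Ω → ℝ}

/-- The reinforced local times at the `n`-th jump, in terms of vertices and holding times. -/
def reinforced (J : ℕ → Ω → V) (σ : ℕ → Ω → ℝ) (n : ℕ) (ω : Ω) (j : V) : ℝ :=
  1 + ∑ m ∈ Finset.range n, if J m ω = j then σ m ω else 0

/-- The state (present vertex, reinforced local times) at the `n`-th jump. -/
def state (J : ℕ → Ω → V) (σ : ℕ → Ω → ℝ) (n : ℕ) (ω : Ω) : V × (V → ℝ) :=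
  (J n ω, reinforced J σ n ω)

lemma reinforced_succ (n : ℕ) (ω : Ω) :
    reinforced J σ (n + 1) ω = advance (J n ω) (reinforced J σ n ω) (σ n ω) := by
  funext j
  simp [reinforced, advance, Finset.sum_range_succ, add_assoc]

/-- On paths with positive holding times, the local times at the jumps are `reinforced`. -/
lemma L_jumpTime_eq {y : ℝ → V} {ω : Ω}
    (hpath : ∀ n t, jumpTime σ n ω ≤ t → t < jumpTime σ (n + 1) ω → y t = J n ω)
    (hpos : ∀ n, 0 < σ n ω) :
    IsStepPath y (fun n => J n ω) (fun n => jumpTime σ n ω) ∧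
    ∀ n j, 1 + occupation (fun n => J n ω) (fun n => jumpTime σ n ω) n j = reinforced J σ n ω j ∧
      L y j (jumpTime σ n ω) = reinforced J σ n ω j := by
  have hsucc : ∀ n, jumpTime σ (n + 1) ω - jumpTime σ n ω = σ n ω := fun n => by
    simp [jumpTime, Finset.sum_range_succ]
  have hp : IsStepPath y (fun n => J n ω) (fun n => jumpTime σ n ω) :=
    ⟨by simp [jumpTime], strictMono_nat_of_lt_succ fun n => by linarith [hsucc n, hpos n], hpath⟩
  refine ⟨hp, fun n j => ?_⟩
  have h1 : 1 + occupation (fun n => J n ω) (fun n => jumpTime σ n ω) n j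
      = reinforced J σ n ω j := by
    simp only [occupation, reinforced, hsucc]
  exact ⟨h1, by rw [L, hp.localTime_jump, h1]⟩

lemma one_le_L (y : ℝ → V) (j : V) {t : ℝ} (ht : 0 ≤ t) : 1 ≤ L y j t := by
  rw [L, localTime]
  have := intervalIntegral.integral_nonneg ht (μ := volume)
    (f := Set.indicator {s : ℝ | y s = j} fun _ => (1 : ℝ))
    fun s _ => Set.indicator_nonneg (fun _ _ => zero_le_one) s
  linarith

variable [MeasurableSpace V]

lemma past_le [MeasurableSpace Ω] (hJ : ∀ n, Measurable (J n)) (hσ : ∀ n, Measurable (σ n)) (n : ℕ) :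
    past J σ n ≤ ‹MeasurableSpace Ω› :=
  sup_le (iSup₂_le fun m _ => (hJ m).comap_le) (iSup₂_le fun m _ => (hσ m).comap_le)

lemma past_mono : Monotone (past J σ) := fun m n h =>
  sup_le_sup (biSup_mono fun k hk => Finset.range_mono (by omega) hk)
    (biSup_mono fun k hk => Finset.range_mono h hk)

lemma measurable_vertex_past {m n : ℕ} (h : m ≤ n) : Measurable[past J σ n] (J m) := by
  rw [measurable_iff_comap_le]
  exact le_sup_of_le_left (le_iSup₂_of_le m (Finset.mem_range.2 (by omega)) le_rfl)

lemma measurable_holding_past {m n : ℕ} (h : m < n) : Measurable[past J σ n] (σ m) := by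
  rw [measurable_iff_comap_le]
  exact le_sup_of_le_right (le_iSup₂_of_le m (Finset.mem_range.2 h) le_rfl)

variable [MeasurableSingletonClass V]

lemma measurable_state_past (n : ℕ) : Measurable[past J σ n] (state J σ n) := by
  let _ : MeasurableSpace Ω := past J σ n
  refine (measurable_vertex_past le_rfl).prodMk ?_
  refine measurable_pi_lambda _ fun j => measurable_const.add ?_
  refine Finset.measurable_sum _ fun m hm => ?_
  have hm := Finset.mem_range.1 hm
  exact Measurable.ite (measurable_vertex_past hm.le (measurableSet_singleton j))
    (measurable_holding_past hm) measurable_const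

lemma measurable_advance :
    Measurable fun z : (V × (V → ℝ)) × ℝ => advance z.1.1 z.1.2 z.2 := by
  refine measurable_pi_lambda _ fun j => ?_
  refine ((measurable_pi_apply j).comp (measurable_snd.comp measurable_fst)).add ?_
  exact Measurable.ite ((measurableSet_singleton j).preimage
    (measurable_fst.comp measurable_fst)) measurable_snd measurable_const

end State

/-! ### One-step transition law of the chain -/

section Step

open Classical

variable {V : Type*} [Fintype V]

/-- The joint density of the holding time at `i` and of the event that the next vertex is `k`. -/
def stepDensity (G : SimpleGraph V) (W : Sym2 V → ℝ) (k : V) (x : V × (V → ℝ)) (s : ℝ) : ℝ :=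
  rate G W x.1 x.2 k * Real.exp (-(totalRate G W x.1 x.2 * s))

/-- The transition operator of the chain (present vertex, reinforced local times). -/
def stepIntegral (G : SimpleGraph V) (W : Sym2 V → ℝ) (g : V × (V → ℝ) → ENNReal)
    (x : V × (V → ℝ)) : ENNReal :=
  ∑ k, ∫⁻ s in Set.Ioi 0, ENNReal.ofReal (stepDensity G W k x s) * g (k, advance x.1 x.2 s)

variable {G : SimpleGraph V} {W : Sym2 V → ℝ}

lemma totalRate_pos [Nontrivial V] (hG : G.Connected) (hW : ∀ e ∈ G.edgeSet, 0 < W e)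
    {ℓ : V → ℝ} (hℓ : ∀ j, 0 < ℓ j) (i : V) : 0 < totalRate G W i ℓ := by
  obtain ⟨j, hj⟩ := hG.preconnected.exists_adj_of_nontrivial i
  exact (mul_pos (weight_pos hW hj) (hℓ j)).trans_le
    (weight_mul_le_totalRate hW (fun j => (hℓ j).le) i j)

variable [MeasurableSpace V]

variable {i₀ : V} {Ω : Type*} [MeasurableSpace Ω] {P : Measure Ω} [IsProbabilityMeasure P]
  {Y : ℝ → Ω → V} {J : ℕ → Ω → V} {σ : ℕ → Ω → ℝ}

/-- The conditional law of one step, integrated over an event of the past. -/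
lemma IsVRJPWith.measure_inter (h : IsVRJPWith G W i₀ P Y J σ) (n : ℕ) {F : Set Ω}
    (hF : MeasurableSet[past J σ n] F) {S : Set (ℝ × V)} (hS : MeasurableSet S) :
    P (F ∩ (fun ω => (σ n ω, J (n + 1) ω)) ⁻¹' S) = ∫⁻ ω in F, ENNReal.ofReal
      ((stepLaw G W (J n ω) (fun j => L (fun s => Y s ω) j (jumpTime σ n ω))).real S) ∂P := by
  have hle := past_le h.measurable_vertex h.measurable_holding n
  have hpre : MeasurableSet ((fun ω => (σ n ω, J (n + 1) ω)) ⁻¹' S) :=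
    ((h.measurable_holding n).prodMk (h.measurable_vertex (n + 1))) hS
  have hst := h.step n S hS
  have hint : Integrable (((fun ω => (σ n ω, J (n + 1) ω)) ⁻¹' S).indicator
      (fun _ => (1 : ℝ))) P := (integrable_const 1).indicator hpre
  have h1 := setIntegral_condExp hle hint hF
  rw [setIntegral_congr_ae (hle F hF) (hst.mono fun ω hω _ => hω),
    setIntegral_indicator hpre, setIntegral_const, smul_eq_mul, mul_one] at h1
  rw [← ofReal_integral_eq_lintegral_ofReal, h1, ofReal_measureReal]
  · exact (integrable_condExp.congr hst).integrableOn
  · exact Eventually.of_forall fun ω => measureReal_nonneg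

variable [MeasurableSingletonClass V]

lemma measurable_rate (k : V) : Measurable fun x : V × (V → ℝ) => rate G W x.1 x.2 k := by
  refine measurable_from_prod_countable_right fun i => ?_
  simp only [rate_eq]
  fun_prop

lemma measurable_totalRate : Measurable fun x : V × (V → ℝ) => totalRate G W x.1 x.2 :=
  Finset.measurable_sum _ fun k _ => measurable_rate k

lemma measurable_stepDensity (k : V) :
    Measurable fun z : (V × (V → ℝ)) × ℝ => stepDensity G W k z.1 z.2 := by
  exact ((measurable_rate k).comp measurable_fst).mul
    (Real.measurable_exp.comp ((measurable_totalRate.comp measurable_fst).mul measurable_snd).neg)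

lemma stepLaw_prod_singleton (hW : ∀ e ∈ G.edgeSet, 0 < W e) {i : V} {ℓ : V → ℝ}
    (hℓ : ∀ j, 0 ≤ ℓ j) (hr : 0 < totalRate G W i ℓ) {B : Set ℝ} (hB : MeasurableSet B) (k : V) :
    stepLaw G W i ℓ (B ×ˢ {k})
      = ∫⁻ s in Set.Ioi 0 ∩ B, ENNReal.ofReal (stepDensity G W k (i, ℓ) s) := by
  have hk := rate_nonneg hW hℓ i k
  rw [stepLaw, if_neg hr.ne', Measure.prod_prod, Measure.finsetSum_apply,
    Finset.sum_eq_single k (fun j _ hj => by simp [hj]) (by simp), expMeasure, gammaMeasure,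
    withDensity_apply _ hB, Set.inter_comm, ← Measure.restrict_restrict hB]
  change (∫⁻ s in B, exponentialPDF _ s) * _ = _
  simp only [Measure.smul_apply, smul_eq_mul, Measure.dirac_apply, Set.indicator_of_mem,
    Set.mem_singleton, Pi.one_apply, mul_one]
  rw [← lintegral_mul_const _
      (by exact (measurable_exponentialPDFReal _).ennreal_ofReal), Measure.restrict_restrict hB,
    Set.inter_comm, ← Measure.restrict_restrict measurableSet_Ioi, ← lintegral_indicator measurableSet_Ioi]
  refine lintegral_congr_ae ?_
  have : ∀ᵐ s ∂(volume.restrict B), s ≠ 0 := ae_restrict_of_ae (by simp [ae_iff])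
  filter_upwards [this] with s hs
  rw [exponentialPDF_eq]
  rcases lt_or_gt_of_ne hs with h | h
  · simp [h.not_ge, h.le]
  · rw [if_pos h.le, Set.indicator_of_mem (by exact h), ← ENNReal.ofReal_mul (by positivity)]
    congr 1
    simp only [stepDensity]
    field_simp

/-- Positivity comes from the exponential law, which applies only when the total rate is positive.
That needs the local times at the `n`-th jump to be positive, hence a nonnegative jump time: thus
the strong induction on earlier holding times. -/
lemma IsVRJPWith.ae_holding_pos [Nontrivial V] (hG : G.Connected)
    (hW : ∀ e ∈ G.edgeSet, 0 < W e) (h : IsVRJPWith G W i₀ P Y J σ) :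
    ∀ᵐ ω ∂P, ∀ n, 0 < σ n ω := by
  rw [ae_all_iff]
  intro n
  induction n using Nat.strong_induction_on with
  | _ n ih =>
    have ih' : ∀ᵐ ω ∂P, ∀ m ∈ Finset.range n, 0 < σ m ω := by
      refine (ae_ball_iff (Finset.range n).countable_toSet).2 ?_
      exact fun m hm => ih m (Finset.mem_range.1 hm)
    have key : ∀ k, ∀ᵐ ω ∂P, ¬ (σ n ω ≤ 0 ∧ J (n + 1) ω = k) := by
      intro k
      have h1 := h.measure_inter n (F := Set.univ) MeasurableSet.univ
        (S := Set.Iic 0 ×ˢ {k}) (measurableSet_Iic.prod (measurableSet_singleton k))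
      rw [lintegral_congr_ae (g := fun _ => 0)] at h1
      · rw [ae_iff]
        simpa [Set.preimage, Set.inter_def] using h1
      · filter_upwards [ae_restrict_of_ae ih'] with ω hω
        have ht : 0 ≤ jumpTime σ n ω := Finset.sum_nonneg fun m hm => (hω m hm).le
        have hL : ∀ j, 0 < L (fun s => Y s ω) j (jumpTime σ n ω) := fun j =>
          zero_lt_one.trans_le (one_le_L _ j ht)
        rw [measureReal_def, stepLaw_prod_singleton hW (fun j => (hL j).le)
          (totalRate_pos hG hW hL _) measurableSet_Iic,
          Set.Ioi_inter_Iic, Set.Ioc_self]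
        simp
    filter_upwards [ae_all_iff.2 key] with ω hω
    by_contra! hcon
    exact hω _ ⟨hcon, rfl⟩

/-- Replaces the local times of the path `Y` by functions of vertices and holding times, which makes
`state` a Markov chain. -/
lemma IsVRJPWith.ae_good [Nontrivial V] (hG : G.Connected) (hW : ∀ e ∈ G.edgeSet, 0 < W e)
    (h : IsVRJPWith G W i₀ P Y J σ) : ∀ᵐ ω ∂P, (∀ n, 0 < σ n ω) ∧
      (∀ n j, 1 ≤ reinforced J σ n ω j) ∧
      ∀ n j, L (fun s => Y s ω) j (jumpTime σ n ω) = reinforced J σ n ω j := by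
  filter_upwards [h.ae_holding_pos hG hW, h.path] with ω h1 h2
  refine ⟨h1, fun n j => ?_, fun n j => ((L_jumpTime_eq h2 h1).2 n j).2⟩
  rw [reinforced, le_add_iff_nonneg_right]
  refine Finset.sum_nonneg fun m _ => ?_
  split_ifs
  · exact (h1 m).le
  · exact le_rfl

/-- The joint law of the state and the next holding time, on an event of the past and on the event
that the next vertex is `k`. -/
lemma IsVRJPWith.map_state_holding [Nontrivial V] (hG : G.Connected)
    (hW : ∀ e ∈ G.edgeSet, 0 < W e) (h : IsVRJPWith G W i₀ P Y J σ) (n : ℕ) {F : Set Ω}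
    (hF : MeasurableSet[past J σ n] F) (k : V) :
    (P.restrict (F ∩ J (n + 1) ⁻¹' {k})).map (fun ω => (state J σ n ω, σ n ω))
      = (((P.restrict F).map (state J σ n)).prod (volume.restrict (Set.Ioi 0))).withDensity
        (fun z => ENNReal.ofReal (stepDensity G W k z.1 z.2)) := by
  have hle := past_le h.measurable_vertex h.measurable_holding n
  have hst : Measurable (state J σ n) := (measurable_state_past n).mono hle le_rfl
  have hdens := (measurable_stepDensity (G := G) (W := W) k).ennreal_ofReal
  have hJk : MeasurableSet (J (n + 1) ⁻¹' {k}) :=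
    h.measurable_vertex (n + 1) (measurableSet_singleton k)
  -- It suffices to test rectangles: the constraint `D` on the state is a past event and joins `F`,
  -- leaving the event `B ×ˢ {k}` for the step.
  refine Measure.ext_prod fun {D B} hD hB => ?_
  have hD' : MeasurableSet[past J σ n] (F ∩ state J σ n ⁻¹' D) :=
    hF.inter (measurable_state_past n hD)
  rw [Measure.map_apply (hst.prodMk (h.measurable_holding n)) (hD.prod hB),
    Measure.restrict_apply (hst.prodMk (h.measurable_holding n) (hD.prod hB)),
    withDensity_apply _ (hD.prod hB), ← Measure.prod_restrict,
    lintegral_prod _ hdens.aemeasurable, Measure.restrict_map hst hD,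
    lintegral_map hdens.lintegral_prod_right' hst,
    Measure.restrict_restrict (hst hD), Measure.restrict_restrict hB]
  have hset : (fun ω => (state J σ n ω, σ n ω)) ⁻¹' D ×ˢ B ∩ (F ∩ J (n + 1) ⁻¹' {k})
      = (F ∩ state J σ n ⁻¹' D) ∩ (fun ω => (σ n ω, J (n + 1) ω)) ⁻¹' (B ×ˢ {k}) := by
    ext ω; simp; tauto
  rw [hset, h.measure_inter n hD' (hB.prod (measurableSet_singleton k)), Set.inter_comm F]
  refine lintegral_congr_ae (ae_restrict_of_ae ?_)
  filter_upwards [h.ae_good hG hW] with ω ⟨_, h1, h2⟩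
  simp only [h2]
  have hpos : ∀ j, 0 < reinforced J σ n ω j := fun j => zero_lt_one.trans_le (h1 n j)
  have hr := totalRate_pos hG hW hpos (J n ω)
  have : IsProbabilityMeasure (expMeasure (totalRate G W (J n ω) (reinforced J σ n ω))) :=
    isProbabilityMeasure_expMeasure hr
  rw [measureReal_def, ENNReal.ofReal_toReal, stepLaw_prod_singleton hW
    (fun j => (hpos j).le) hr hB, Set.inter_comm]
  · rfl
  · rw [stepLaw, if_neg hr.ne', Measure.prod_prod]
    refine ENNReal.mul_ne_top (measure_ne_top _ _) ?_
    simp [Measure.finsetSum_apply, Set.indicator_apply]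

/-- The chain `state` has transition operator `stepIntegral`. -/
lemma IsVRJPWith.setLIntegral_succ [Nontrivial V] (hG : G.Connected)
    (hW : ∀ e ∈ G.edgeSet, 0 < W e) (h : IsVRJPWith G W i₀ P Y J σ) (n : ℕ) {F : Set Ω}
    (hF : MeasurableSet[past J σ n] F) {g : V × (V → ℝ) → ENNReal} (hg : Measurable g) :
    ∫⁻ ω in F, g (state J σ (n + 1) ω) ∂P = ∫⁻ ω in F, stepIntegral G W g (state J σ n ω) ∂P := by
  have hle := past_le h.measurable_vertex h.measurable_holding n
  have hst : Measurable (state J σ n) := (measurable_state_past n).mono hle le_rfl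
  have hσ := h.measurable_holding n
  have hadv : ∀ k, Measurable fun z : (V × (V → ℝ)) × ℝ => g (k, advance z.1.1 z.1.2 z.2) :=
    fun k => hg.comp (measurable_const.prodMk measurable_advance)
  have hdens := fun k => (measurable_stepDensity (G := G) (W := W) k).ennreal_ofReal
  have hJk : ∀ k, MeasurableSet (J (n + 1) ⁻¹' {k}) := fun k =>
    h.measurable_vertex (n + 1) (measurableSet_singleton k)
  have h1 : ∀ ω, g (state J σ (n + 1) ω) = ∑ k, (J (n + 1) ⁻¹' {k}).indicator
      (fun ω => g (k, advance (state J σ n ω).1 (state J σ n ω).2 (σ n ω))) ω := fun ω => by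
    rw [Finset.sum_eq_single (J (n + 1) ω) (fun k _ hk => by simp [hk.symm]) (by simp)]
    simp [state, reinforced_succ]
  simp only [h1, stepIntegral]
  rw [lintegral_finsetSum _ fun k _ => by
      exact Measurable.indicator ((hadv k).comp (hst.prodMk hσ)) (hJk k), lintegral_finsetSum]
  · refine Finset.sum_congr rfl fun k _ => ?_
    have hmap := h.map_state_holding hG hW n hF k
    rw [lintegral_indicator (hJk k), Measure.restrict_restrict (hJk k), Set.inter_comm,
      ← lintegral_map (f := fun z : (V × (V → ℝ)) × ℝ => g (k, advance z.1.1 z.1.2 z.2))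
        (hadv k) (hst.prodMk hσ), hmap,
      lintegral_withDensity_eq_lintegral_mul _ (hdens k) (hadv k),
      lintegral_prod _ ((hdens k).mul (hadv k)).aemeasurable,
      lintegral_map ((hdens k).mul (hadv k)).lintegral_prod_right' hst]
    rfl
  · intro k _
    exact (((hdens k).mul (hadv k)).lintegral_prod_right' (ν := volume.restrict (Set.Ioi 0))).comp
      hst

end Step

/-! ### Two exponential integrals -/

section Integrals

lemma lintegral_Ioi_ofReal_of_hasDerivAt {f F : ℝ → ℝ}
    (hF : ∀ s ∈ Set.Ici (0 : ℝ), HasDerivAt F (f s) s) (hf : ∀ s ∈ Set.Ioi (0 : ℝ), 0 ≤ f s)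
    (hlim : Tendsto F atTop (𝓝 0)) :
    ∫⁻ s in Set.Ioi 0, ENNReal.ofReal (f s) = ENNReal.ofReal (-F 0) := by
  rw [← ofReal_integral_eq_lintegral_ofReal (integrableOn_Ioi_deriv_of_nonneg' hF hf hlim)
    ((ae_restrict_iff' measurableSet_Ioi).2 (Eventually.of_forall hf)),
    integral_Ioi_of_hasDerivAt_of_nonneg' hF hf hlim, zero_sub]

lemma tendsto_exp_neg_mul {r : ℝ} (hr : 0 < r) :
    Tendsto (fun s : ℝ => Real.exp (-(r * s))) atTop (𝓝 0) :=
  Real.tendsto_exp_neg_atTop_nhds_zero.comp (tendsto_id.const_mul_atTop hr)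

lemma hasDerivAt_exp_neg_mul (r s : ℝ) :
    HasDerivAt (fun s : ℝ => Real.exp (-(r * s))) (-(r * Real.exp (-(r * s)))) s := by
  refine (((hasDerivAt_id' s).const_mul r).neg).exp.congr_deriv ?_
  simp only [Pi.neg_apply]
  ring

/-- The integrand is the exact derivative of `-c * exp (-r s) / (ℓ + s)`; the correction `1 / (ℓ +
s)²` is what makes it exact. -/
lemma lintegral_exp_mul_inv {r ℓ c : ℝ} (hr : 0 < r) (hℓ : 0 < ℓ) (hc : 0 ≤ c) :
    ∫⁻ s in Set.Ioi 0, ENNReal.ofReal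
      (c * (Real.exp (-(r * s)) * (r / (ℓ + s) + 1 / (ℓ + s) ^ 2))) = ENNReal.ofReal (c / ℓ) := by
  rw [lintegral_Ioi_ofReal_of_hasDerivAt (F := fun s => -c * (Real.exp (-(r * s)) * (ℓ + s)⁻¹))]
  · simp [div_eq_mul_inv]
  · intro s hs
    have hs : (0 : ℝ) ≤ s := hs
    have hne : ℓ + s ≠ 0 := by positivity
    refine (((hasDerivAt_exp_neg_mul r s).mul
      (((hasDerivAt_id' s).const_add ℓ).inv hne)).const_mul (-c)).congr_deriv ?_
    simp only [Pi.inv_apply]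
    field_simp
    ring
  · intro s hs
    have hs : (0 : ℝ) < s := hs
    positivity
  · have h1 : Tendsto (fun s : ℝ => (ℓ + s)⁻¹) atTop (𝓝 0) :=
      (tendsto_atTop_add_const_left _ ℓ tendsto_id).inv_tendsto_atTop
    simpa using ((tendsto_exp_neg_mul hr).mul h1).const_mul (-c)

lemma lintegral_exp_mul_affine {r a b c : ℝ} (hr : 0 < r) (ha : 0 ≤ a) (hb : 0 ≤ b)
    (hc : 0 ≤ c) :
    ∫⁻ s in Set.Ioi 0, ENNReal.ofReal (c * (Real.exp (-(r * s)) * (a + b * s)))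
      = ENNReal.ofReal (c * (a / r + b / r ^ 2)) := by
  rw [lintegral_Ioi_ofReal_of_hasDerivAt
    (F := fun s => -c * (Real.exp (-(r * s)) * ((a / r + b / r ^ 2) + b / r * s)))]
  · simp
  · intro s hs
    refine (((hasDerivAt_exp_neg_mul r s).mul (((hasDerivAt_id' s).const_mul
      (b / r)).const_add (a / r + b / r ^ 2))).const_mul (-c)).congr_deriv ?_
    field_simp
    ring
  · intro s hs
    have hs : (0 : ℝ) < s := hs
    positivity
  · have h1 : Tendsto (fun s : ℝ => r * s * Real.exp (-(r * s))) atTop (𝓝 0) := by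
      have := (Real.tendsto_pow_mul_exp_neg_atTop_nhds_zero 1).comp
        (tendsto_id.const_mul_atTop hr)
      simpa [Function.comp_def] using this
    have h2 := (((tendsto_exp_neg_mul hr).mul_const (a / r + b / r ^ 2)).add
      (h1.const_mul (b / r ^ 2))).const_mul (-c)
    simp only [zero_mul, mul_zero, add_zero] at h2
    refine h2.congr fun s => ?_
    field_simp

end Integrals

/-! ### The martingale, non-explosion and the limit -/

section Martingale

open Classical

variable {V : Type*} [Fintype V] {G : SimpleGraph V} {W : Sym2 V → ℝ}

/-- The function `r_j(ℓ) / ℓ_j + 1{i ≠ j} / ℓ_j²` of the state `(i, ℓ)`, which is harmonic for the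
transition operator `stepIntegral`. -/
def harmonic (G : SimpleGraph V) (W : Sym2 V → ℝ) (j : V) (x : V × (V → ℝ)) : ℝ :=
  totalRate G W j x.2 / x.2 j + if x.1 = j then 0 else 1 / x.2 j ^ 2

lemma totalRate_nonneg (hW : ∀ e ∈ G.edgeSet, 0 < W e) {ℓ : V → ℝ} (hℓ : ∀ j, 0 ≤ ℓ j) (i : V) :
    0 ≤ totalRate G W i ℓ :=
  Finset.sum_nonneg fun k _ => rate_nonneg hW hℓ i k

lemma harmonic_nonneg (hW : ∀ e ∈ G.edgeSet, 0 < W e) (j : V) {x : V × (V → ℝ)}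
    (hx : ∀ j, 0 < x.2 j) : 0 ≤ harmonic G W j x := by
  have h1 := totalRate_nonneg hW (fun j => (hx j).le) j
  have h2 := hx j
  unfold harmonic
  split_ifs <;> positivity

lemma totalRate_advance (i j : V) (ℓ : V → ℝ) (s : ℝ) :
    totalRate G W j (advance i ℓ s) = totalRate G W j ℓ + weight G W j i * s := by
  simp [totalRate_eq, advance, mul_add, Finset.sum_add_distrib]

/-- During a sojourn at `j`, `r_j` is constant and the next vertex is not `j`, so the integrals sum
to `r_j / ℓ_j`. During a sojourn at `i ≠ j`, `ℓ_j` is constant: the mean gain `W_{ij} / (r_i ℓ_j)`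
in `r_j / ℓ_j` equals the mean loss of `1 / ℓ_j²`, which occurs with probability `W_{ij} ℓ_j / r_i`.
-/
lemma stepIntegral_harmonic (hW : ∀ e ∈ G.edgeSet, 0 < W e) (j : V) {x : V × (V → ℝ)}
    (hx : ∀ j, 0 < x.2 j) (hr : 0 < totalRate G W x.1 x.2) :
    stepIntegral G W (fun x => ENNReal.ofReal (harmonic G W j x)) x
      = ENNReal.ofReal (harmonic G W j x) := by
  obtain ⟨i, ℓ⟩ := x
  dsimp only at hx hr
  have hℓ : ∀ j, 0 ≤ ℓ j := fun j => (hx j).le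
  have hrate := fun k => rate_nonneg hW hℓ i k
  have hprod : ∀ k s, ENNReal.ofReal (stepDensity G W k (i, ℓ) s)
      * ENNReal.ofReal (harmonic G W j (k, advance i ℓ s))
      = ENNReal.ofReal (rate G W i ℓ k * (Real.exp (-(totalRate G W i ℓ * s))
        * harmonic G W j (k, advance i ℓ s))) := fun k s => by
    rw [stepDensity, ← ENNReal.ofReal_mul (mul_nonneg (hrate k) (Real.exp_pos _).le), mul_assoc]
  simp only [stepIntegral, hprod]
  by_cases hij : i = j
  · subst hij
    have hterm : ∀ k s, rate G W i ℓ k * (Real.exp (-(totalRate G W i ℓ * s))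
        * harmonic G W i (k, advance i ℓ s))
        = rate G W i ℓ k * (Real.exp (-(totalRate G W i ℓ * s))
          * (totalRate G W i ℓ / (ℓ i + s) + 1 / (ℓ i + s) ^ 2)) := fun k s => by
      by_cases hk : k = i
      · subst hk
        simp [rate_eq, weight_self]
      · simp only [harmonic, totalRate_advance, weight_self, if_neg hk]
        simp [advance]
    simp only [hterm, lintegral_exp_mul_inv hr (hx i) (hrate _)]
    rw [← ENNReal.ofReal_sum_of_nonneg fun k _ => div_nonneg (hrate k) (hℓ i), ← Finset.sum_div]
    simp [harmonic, totalRate]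
  · set d : V → ℝ := fun k => if k = j then 0 else 1 / ℓ j ^ 2 with hd
    have hd0 : ∀ k, 0 ≤ d k := fun k => by
      have := hx j
      simp only [hd]
      split_ifs <;> positivity
    have hrj := totalRate_nonneg hW hℓ j
    have hterm : ∀ k s, harmonic G W j (k, advance i ℓ s)
        = (totalRate G W j ℓ / ℓ j + d k) + weight G W j i / ℓ j * s := fun k s => by
      simp only [harmonic, totalRate_advance, hd]
      simp only [advance, if_neg hij, add_zero]
      ring
    simp only [hterm]
    have hint := fun k => lintegral_exp_mul_affine hr
      (add_nonneg (div_nonneg hrj (hℓ j)) (hd0 k))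
      (div_nonneg (weight_nonneg hW j i) (hℓ j)) (hrate k)
    simp only [hint]
    rw [← ENNReal.ofReal_sum_of_nonneg fun k _ => mul_nonneg (hrate k) (add_nonneg
      (div_nonneg (add_nonneg (div_nonneg hrj (hℓ j)) (hd0 k)) hr.le)
      (div_nonneg (div_nonneg (weight_nonneg hW j i) (hℓ j)) (by positivity)))]
    congr 1
    have hsum1 : ∑ k, rate G W i ℓ k = totalRate G W i ℓ := rfl
    have hsum2 : ∑ k, rate G W i ℓ k * d k
        = (totalRate G W i ℓ - weight G W i j * ℓ j) * (1 / ℓ j ^ 2) := by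
      have h1 : ∀ k, rate G W i ℓ k * d k = rate G W i ℓ k * (1 / ℓ j ^ 2)
          - if k = j then rate G W i ℓ j * (1 / ℓ j ^ 2) else 0 := fun k => by
        by_cases hk : k = j
        · subst hk; simp [hd]
        · simp [hd, hk]
      simp only [h1, Finset.sum_sub_distrib, ← Finset.sum_mul, hsum1]
      simp [rate_eq]
      ring
    have hexp : ∀ k, rate G W i ℓ k * ((totalRate G W j ℓ / ℓ j + d k) / totalRate G W i ℓ
          + weight G W j i / ℓ j / totalRate G W i ℓ ^ 2)
        = rate G W i ℓ k * (totalRate G W j ℓ / ℓ j / totalRate G W i ℓ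
          + weight G W j i / ℓ j / totalRate G W i ℓ ^ 2)
          + rate G W i ℓ k * d k / totalRate G W i ℓ := fun k => by ring
    simp only [hexp, Finset.sum_add_distrib, ← Finset.sum_mul, ← Finset.sum_div, hsum1, hsum2]
    rw [weight_comm G W j i, harmonic, if_neg hij]
    have := (hx j).ne'
    have := hr.ne'
    field_simp
    ring

/-- A Gaussian function of the total local time contracts under the transition operator. -/
lemma exists_stepIntegral_le (hW : ∀ e ∈ G.edgeSet, 0 < W e) : ∃ ρ : ℝ, 0 ≤ ρ ∧ ρ < 1 ∧
    ∀ x : V × (V → ℝ), (∀ j, 0 < x.2 j) → 0 < totalRate G W x.1 x.2 →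
      stepIntegral G W (fun x => ENNReal.ofReal (Real.exp (-(∑ j, x.2 j) ^ 2))) x
        ≤ ENNReal.ofReal ρ * ENNReal.ofReal (Real.exp (-(∑ j, x.2 j) ^ 2)) := by
  set C := ∑ i, ∑ k, weight G W i k with hC
  have hCnn : 0 ≤ C := Finset.sum_nonneg fun i _ => Finset.sum_nonneg fun k _ =>
    weight_nonneg hW i k
  -- With total `S`, the bound `(S + s)² ≥ S² + 2 S s` gives the factor `r / (r + 2 S)`, and `r ≤ C
  -- S` gives this ratio.
  refine ⟨C / (C + 2), by positivity, by rw [div_lt_one (by positivity)]; linarith, ?_⟩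
  rintro ⟨i, ℓ⟩ hx hr
  dsimp only at hx hr ⊢
  have hℓ : ∀ j, 0 ≤ ℓ j := fun j => (hx j).le
  have hrate := fun k => rate_nonneg hW hℓ i k
  set S := ∑ j, ℓ j with hS
  set r := totalRate G W i ℓ with hrdef
  have hS0 : 0 ≤ S := Finset.sum_nonneg fun j _ => hℓ j
  have hrC : r ≤ C * S := by
    calc r = ∑ k, weight G W i k * ℓ k := totalRate_eq i ℓ
      _ ≤ ∑ k, weight G W i k * S := Finset.sum_le_sum fun k _ =>
          mul_le_mul_of_nonneg_left (Finset.single_le_sum (f := ℓ) (fun k _ => hℓ k)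
            (Finset.mem_univ k)) (weight_nonneg hW i k)
      _ = (∑ k, weight G W i k) * S := by rw [Finset.sum_mul]
      _ ≤ C * S := mul_le_mul_of_nonneg_right (Finset.single_le_sum
          (f := fun i => ∑ k, weight G W i k)
          (fun i _ => Finset.sum_nonneg fun k _ => weight_nonneg hW i k) (Finset.mem_univ i)) hS0
  have hterm : ∀ k, ∫⁻ s in Set.Ioi 0, ENNReal.ofReal (stepDensity G W k (i, ℓ) s)
      * ENNReal.ofReal (Real.exp (-(∑ j, advance i ℓ s j) ^ 2))
      ≤ ENNReal.ofReal (rate G W i ℓ k * Real.exp (-S ^ 2) * (1 / (r + 2 * S) + 0 / (r + 2 * S) ^ 2)) := by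
    intro k
    rw [← lintegral_exp_mul_affine (by positivity) zero_le_one le_rfl
      (mul_nonneg (hrate k) (Real.exp_pos _).le)]
    refine setLIntegral_mono' measurableSet_Ioi fun s hs => ?_
    rw [stepDensity, ← ENNReal.ofReal_mul (mul_nonneg (hrate k) (Real.exp_pos _).le)]
    refine ENNReal.ofReal_le_ofReal ?_
    rw [mul_assoc, mul_assoc, zero_mul, add_zero, mul_one, ← Real.exp_add, ← Real.exp_add]
    refine mul_le_mul_of_nonneg_left (Real.exp_le_exp.2 ?_) (hrate k)
    have : ∑ j, advance i ℓ s j = S + s := by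
      simp [advance, Finset.sum_add_distrib, hS]
    rw [this]
    nlinarith [sq_nonneg s]
  refine (Finset.sum_le_sum fun k _ => hterm k).trans ?_
  rw [← ENNReal.ofReal_sum_of_nonneg fun k _ => mul_nonneg
    (mul_nonneg (hrate k) (Real.exp_pos _).le) (by positivity), ← ENNReal.ofReal_mul (by positivity)]
  refine ENNReal.ofReal_le_ofReal ?_
  rw [← Finset.sum_mul, ← Finset.sum_mul]
  change r * _ * _ ≤ _
  have hfrac : r / (r + 2 * S) ≤ C / (C + 2) := by
    rw [div_le_div_iff₀ (by positivity) (by positivity)]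
    nlinarith
  calc r * Real.exp (-S ^ 2) * (1 / (r + 2 * S) + 0 / (r + 2 * S) ^ 2)
      = r / (r + 2 * S) * Real.exp (-S ^ 2) := by ring
    _ ≤ _ := mul_le_mul_of_nonneg_right hfrac (Real.exp_pos _).le

variable [MeasurableSpace V] [MeasurableSingletonClass V]

lemma measurable_harmonic (j : V) : Measurable (harmonic G W j) := by
  have h1 : Measurable fun x : V × (V → ℝ) => x.2 j := (measurable_pi_apply j).comp measurable_snd
  have h2 : Measurable fun x : V × (V → ℝ) => totalRate G W j x.2 :=
    (continuous_totalRate j).measurable.comp measurable_snd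
  exact (h2.div h1).add (Measurable.ite (measurable_fst (measurableSet_singleton j))
    measurable_const (measurable_const.div (h1.pow_const 2)))

variable {i₀ : V} {Ω : Type*} [MeasurableSpace Ω] {P : Measure Ω} [IsProbabilityMeasure P]
  {Y : ℝ → Ω → V} {J : ℕ → Ω → V} {σ : ℕ → Ω → ℝ}

lemma IsVRJPWith.setLIntegral_harmonic_succ [Nontrivial V] (hG : G.Connected)
    (hW : ∀ e ∈ G.edgeSet, 0 < W e) (h : IsVRJPWith G W i₀ P Y J σ) (j : V) (n : ℕ) {F : Set Ω}
    (hF : MeasurableSet[past J σ n] F) :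
    ∫⁻ ω in F, ENNReal.ofReal (harmonic G W j (state J σ (n + 1) ω)) ∂P
      = ∫⁻ ω in F, ENNReal.ofReal (harmonic G W j (state J σ n ω)) ∂P := by
  rw [h.setLIntegral_succ hG hW n hF
    (g := fun x => ENNReal.ofReal (harmonic G W j x)) (measurable_harmonic j).ennreal_ofReal]
  refine lintegral_congr_ae (ae_restrict_of_ae ?_)
  filter_upwards [h.ae_good hG hW] with ω ⟨_, h1, _⟩
  have hpos : ∀ j, 0 < reinforced J σ n ω j := fun j => zero_lt_one.trans_le (h1 n j)
  exact stepIntegral_harmonic hW j hpos (totalRate_pos hG hW hpos _)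

/-- The process `harmonic j` along the chain converges almost surely, as a positive martingale. -/
lemma IsVRJPWith.ae_tendsto_harmonic [Nontrivial V] (hG : G.Connected)
    (hW : ∀ e ∈ G.edgeSet, 0 < W e) (h : IsVRJPWith G W i₀ P Y J σ) (j : V) :
    ∀ᵐ ω ∂P, ∃ c, Tendsto (fun n => harmonic G W j (state J σ n ω)) atTop (𝓝 c) := by
  have hle := past_le h.measurable_vertex h.measurable_holding
  let ℱ : Filtration ℕ ‹MeasurableSpace Ω› := ⟨past J σ, past_mono, hle⟩
  set f : ℕ → Ω → ℝ := fun n ω => harmonic G W j (state J σ n ω) with hf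
  have hmeas : ∀ n, Measurable[past J σ n] (f n) := fun n =>
    (measurable_harmonic j).comp (measurable_state_past n)
  have hmeas' : ∀ n, Measurable (f n) := fun n => (hmeas n).mono (hle n) le_rfl
  have hnn : ∀ n, 0 ≤ᵐ[P] f n := fun n => by
    filter_upwards [h.ae_good hG hW] with ω ⟨_, h1, _⟩
    exact harmonic_nonneg hW j fun j => zero_lt_one.trans_le (h1 n j)
  -- Bounds the initial value, where all local times are `1` and the correction is at most `1`.
  set R : NNReal := Real.toNNReal (totalRate G W j (fun _ => 1) + 1) with hR
  have hbound : ∀ n, ∫⁻ ω, ENNReal.ofReal (f n ω) ∂P ≤ R := by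
    intro n
    induction n with
    | zero =>
      calc ∫⁻ ω, ENNReal.ofReal (f 0 ω) ∂P ≤ ∫⁻ _, R ∂P := lintegral_mono fun ω => by
            refine ENNReal.ofReal_le_ofReal ?_
            simp only [hf, harmonic, state]
            have : reinforced J σ 0 ω = fun _ => 1 := by funext k; simp [reinforced]
            rw [this]
            by_cases hj : J 0 ω = j <;> simp [hj]
        _ = R := by simp
    | succ n ih =>
      have := h.setLIntegral_harmonic_succ hG hW j n (F := Set.univ) MeasurableSet.univ
      simp only [Measure.restrict_univ] at this
      exact this.trans_le ih
  have hint : ∀ n, Integrable (f n) P := fun n =>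
    (lintegral_ofReal_ne_top_iff_integrable (hmeas' n).aestronglyMeasurable (hnn n)).1
      ((hbound n).trans_lt ENNReal.coe_lt_top).ne
  have hmart : Martingale f ℱ P := by
    refine martingale_of_setIntegral_eq_succ (fun n => (hmeas n).stronglyMeasurable) hint
      fun n s hs => ?_
    rw [integral_eq_lintegral_of_nonneg_ae (ae_restrict_of_ae (hnn n))
        (hmeas' n).aestronglyMeasurable,
      integral_eq_lintegral_of_nonneg_ae (ae_restrict_of_ae (hnn (n + 1)))
        (hmeas' (n + 1)).aestronglyMeasurable, h.setLIntegral_harmonic_succ hG hW j n hs]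
  refine hmart.submartingale.exists_ae_tendsto_of_bdd (R := R) fun n => ?_
  rw [eLpNorm_one_eq_lintegral_enorm, lintegral_congr_ae ((hnn n).mono fun ω hω =>
    Real.enorm_of_nonneg hω)]
  exact hbound n

/-- The total local time tends to infinity along the jumps: the process does not explode. -/
lemma IsVRJPWith.ae_tendsto_sum_reinforced [Nontrivial V] (hG : G.Connected)
    (hW : ∀ e ∈ G.edgeSet, 0 < W e) (h : IsVRJPWith G W i₀ P Y J σ) :
    ∀ᵐ ω ∂P, Tendsto (fun n => ∑ j, reinforced J σ n ω j) atTop atTop := by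
  obtain ⟨ρ, hρ0, hρ1, hρ⟩ := exists_stepIntegral_le (G := G) hW
  set g : V × (V → ℝ) → ENNReal := fun x => ENNReal.ofReal (Real.exp (-(∑ j, x.2 j) ^ 2)) with hg
  have hgm : Measurable g := by
    refine (Real.measurable_exp.comp (Measurable.neg (Measurable.pow_const ?_ 2))).ennreal_ofReal
    exact Finset.measurable_sum _ fun j _ => (measurable_pi_apply j).comp measurable_snd
  have hstate : ∀ n, Measurable (state J σ n) := fun n =>
    (measurable_state_past n).mono (past_le h.measurable_vertex h.measurable_holding n) le_rfl
  have hbound : ∀ n, ∫⁻ ω, g (state J σ n ω) ∂P ≤ ENNReal.ofReal ρ ^ n := by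
    intro n
    induction n with
    | zero =>
      calc ∫⁻ ω, g (state J σ 0 ω) ∂P ≤ ∫⁻ _, 1 ∂P := lintegral_mono fun ω => by
            simp only [hg]
            rw [ENNReal.ofReal_le_one, Real.exp_le_one_iff]
            exact neg_nonpos.2 (sq_nonneg _)
        _ = ENNReal.ofReal ρ ^ 0 := by simp
    | succ n ih =>
      have := h.setLIntegral_succ hG hW n (F := Set.univ) MeasurableSet.univ hgm
      simp only [Measure.restrict_univ] at this
      rw [this, pow_succ']
      calc ∫⁻ ω, stepIntegral G W g (state J σ n ω) ∂P
          ≤ ∫⁻ ω, ENNReal.ofReal ρ * g (state J σ n ω) ∂P := by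
            refine lintegral_mono_ae ?_
            filter_upwards [h.ae_good hG hW] with ω ⟨_, h1, _⟩
            have hpos : ∀ j, 0 < reinforced J σ n ω j := fun j => zero_lt_one.trans_le (h1 n j)
            exact hρ _ hpos (totalRate_pos hG hW hpos _)
        _ = ENNReal.ofReal ρ * ∫⁻ ω, g (state J σ n ω) ∂P :=
            lintegral_const_mul _ (hgm.comp (hstate n))
        _ ≤ _ := by gcongr
  -- Geometric decay makes the series of the `g` almost surely finite, so its terms tend to zero,
  -- which forces the total local time to infinity.
  have hsum : ∫⁻ ω, ∑' n, g (state J σ n ω) ∂P ≠ ⊤ := by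
    rw [lintegral_tsum fun n => by exact (hgm.comp (hstate n)).aemeasurable]
    refine ((ENNReal.tsum_le_tsum hbound).trans_lt ?_).ne
    rw [ENNReal.tsum_geometric, ENNReal.inv_lt_top, tsub_pos_iff_lt, ENNReal.ofReal_lt_one]
    exact hρ1
  filter_upwards [ae_lt_top' (AEMeasurable.tsum
    fun n => (hgm.comp (hstate n)).aemeasurable) hsum, h.ae_good hG hW] with ω hω ⟨_, h1, _⟩
  have hlim := ENNReal.tendsto_atTop_zero_of_tsum_ne_top hω.ne
  refine tendsto_atTop.2 fun b => ?_
  filter_upwards [hlim.eventually_lt_const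
    (ENNReal.ofReal_pos.2 (Real.exp_pos (-b ^ 2)))] with n hn
  have hn := Real.exp_lt_exp.1 ((ENNReal.ofReal_lt_ofReal_iff (Real.exp_pos _)).1 hn)
  have hn : b ^ 2 < (∑ j, reinforced J σ n ω j) ^ 2 := by
    simpa [state] using hn
  exact (lt_of_pow_lt_pow_left₀ 2 (Finset.sum_nonneg fun j _ =>
    zero_le_one.trans (h1 n j)) hn).le

/-- Convergence of the centred local times of the time-changed process. -/
lemma IsVRJPWith.exists_ae_tendsto [Nontrivial V] (hG : G.Connected)
    (hW : ∀ e ∈ G.edgeSet, 0 < W e) (h : IsVRJPWith G W i₀ P Y J σ) :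
    ∃ U : V → Ω → ℝ, (∀ i, Measurable (U i)) ∧ ∀ᵐ ω ∂P, ∀ i : V,
      Tendsto (fun t : ℝ => localTime (timeChange fun s => Y s ω) i t - t / (Fintype.card V : ℝ))
        atTop (𝓝 (U i ω)) := by
  have hstate : ∀ n, Measurable (state J σ n) := fun n =>
    (measurable_state_past n).mono (past_le h.measurable_vertex h.measurable_holding n) le_rfl
  have hlog : ∀ n j, Measurable fun ω => Real.log (reinforced J σ n ω j) := fun n j =>
    Real.measurable_log.comp ((measurable_pi_apply j).comp (measurable_snd.comp (hstate n)))
  have hlim : ∀ i, ∀ᵐ ω ∂P, ∃ u, Tendsto (fun n => Real.log (reinforced J σ n ω i)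
      - (∑ j, Real.log (reinforced J σ n ω j)) / Fintype.card V) atTop (𝓝 u) := fun i => by
    filter_upwards [h.ae_good hG hW, ae_all_iff.2 (h.ae_tendsto_harmonic hG hW),
      h.ae_tendsto_sum_reinforced hG hW] with ω ⟨_, h1, _⟩ h2 h3
    exact exists_tendsto_log_sub hG hW (fun n j => zero_lt_one.trans_le (h1 n j)) h3 h2 i
  choose U hUm hU using fun i => measurable_limit_of_tendsto_metrizable_ae
    (fun n => ((hlog n i).sub ((Finset.measurable_sum _ fun j _ => hlog n j).div_const
      (Fintype.card V : ℝ))).aemeasurable) (hlim i)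
  refine ⟨U, hUm, ?_⟩
  filter_upwards [ae_all_iff.2 hU, h.path, h.ae_good hG hW,
    h.ae_tendsto_sum_reinforced hG hW] with ω hω hpath ⟨hpos, _, _⟩ hsum i
  obtain ⟨hp, hocc⟩ := L_jumpTime_eq hpath hpos
  -- The jump time is the total reinforced local time minus the initial `card V`.
  have hτ : Tendsto (fun n => jumpTime σ n ω) atTop atTop := by
    refine (tendsto_atTop_add_const_left atTop (-(Fintype.card V : ℝ)) hsum).congr fun n => ?_
    simp only [← (hocc n _).1, Finset.sum_add_distrib]
    rw [sum_occupation hp.zero]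
    simp
  refine (hp.timeChange hτ).tendsto_localTime_sub (clock_tendsto hp.zero hp.strictMono hτ) i
    ((hω i).congr fun n => ?_)
  simp only [occupation_clock, clock, (hocc n _).1, Pi.sub_apply]

end Martingale

end VRJP

end

theorem mainTheorem2 {V : Type*} [Fintype V] [MeasurableSpace V] [MeasurableSingletonClass V]
    (G : SimpleGraph V) (hG : G.Connected)
    (W : Sym2 V → ℝ) (hW : ∀ e ∈ G.edgeSet, 0 < W e) (i₀ : V)
    {Ω : Type*} [MeasurableSpace Ω] (P : Measure Ω) [IsProbabilityMeasure P]
    (Y : ℝ → Ω → V) (hY : VRJP.IsVRJP G W i₀ P Y) :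
    ∃ U : V → Ω → ℝ, (∀ i, Measurable (U i)) ∧
      ∀ᵐ ω ∂P, ∀ i : V,
        Tendsto (fun t : ℝ =>
            VRJP.localTime (VRJP.timeChange (fun s => Y s ω)) i t - t / (Fintype.card V : ℝ))
          atTop (𝓝 (U i ω)) := by
  rcases subsingleton_or_nontrivial V with hV | hV
  -- With a single vertex the local time is `t` itself, so the difference is identically zero.
  · refine ⟨fun _ _ => 0, fun _ => measurable_const, Eventually.of_forall fun ω i => ?_⟩
    have hcard : Fintype.card V = 1 :=
      le_antisymm (Fintype.card_le_one_iff_subsingleton.2 hV) (Fintype.card_pos_iff.2 ⟨i⟩)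
    have hset : ∀ y : ℝ → V, {s | y s = i} = Set.univ := fun y =>
      Set.eq_univ_of_forall fun s => Subsingleton.elim _ _
    simp [VRJP.localTime, hset, hcard]
  · obtain ⟨J, σ, h⟩ := hY
    exact h.exists_ae_tendsto hG hW
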